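/- **Definitions.** All compact Hausdorff spaces $X$, $X_j$, $Y$, $Y_j$ below are non-empty, $C(X)$ denotes the algebra of complex-valued continuous functions on $X$, $C_{\mathbb R}(X)\subset C(X)$ the real-valued ones, and $\|\cdot\|_{\infty(X)}$ is the supremum norm. A unital subalgebra $A$ of $C(X)$ equipped with a Banach algebra norm (a complete submultiplicative norm) is *self-adjoint* if it is closed under complex conjugation and every unital multiplicative linear functional on $A$ is the evaluation $f\mapsto f(x)$ at exactly one point $x\in X$. For $f\in C(X)$ and $g\in C(Y)$ let $(f\otimes g)(x,y)=f(x)g(y)$; for a subspace $E$ of $C(X)$, $E\otimes C(Y)$ is the set of finite sums of functions $f\otimes g$ with $f\in E$, $g\in C(Y)$, and $1\otimes C(Y)=\{1\otimes g: g\in C(Y)\}$. Let $B$ be a unital point-separating subalgebra of $C(X)$ equipped with a Banach algebra norm, and suppose that $B$ is self-adjoint. Let $\widetilde B$ be a unital point-separating subalgebra of $C(X\times Y)$ with $B\otimes C(Y)\subset\widetilde B$, equipped with a Banach algebra norm $\|\cdot\|_{\widetilde B}$, and suppose that $\widetilde B$ is self-adjoint. Then $\widetilde B$ is a *natural $C(Y)$-valuezation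 of $B$* if there exist a compact Hausdorff space $\mathfrak M$ and a complex-linear map $D:\widetilde B\to C(\mathfrak M)$ such that $\ker D=1\otimes C(Y)$, $D(C_{\mathbb R}(X\times Y)\cap\widetilde B)\subset C_{\mathbb R}(\mathfrak M)$, and $$\|F\|_{\widetilde B}=\|F\|_{\infty(X\times Y)}+\|D(F)\|_{\infty(\mathfrak M)},\qquad F\in\widetilde B.$$ **Theorem 5.1.** For $j=1,2$ let $\widetilde{B_j}$ be a natural $C(Y_j)$-valuezation of $B_j\subset C(X_j)$, and assume that $$\|(1\otimes h)F\|_{\widetilde{B_j}}=\|F\|_{\widetilde{B_j}}$$ for every $F\in\widetilde{B_j}$ and every $h\in C(Y_j)$ with $|h|=1$ on $Y_j$. Let $U:\widetilde{B_1}\to\widetilde{B_2}$ be a surjective complex-linear isometry. Then there exist $h\in C(Y_2)$ with $|h|=1$ on $Y_2$, a continuous map $\varphi:X_2\times Y_2\to X_1$ such that $\varphi(\cdot,y):X_2\to X_1$ is a homeomorphism for each $y\in Y_2$, and a homeomorphism $\tau:Y_2\to Y_1$ such that $$U(F)(x,y)=h(y)\,F(\varphi(x,y),\tau(y)),\qquad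 (x,y)\in X_2\times Y_2,$$ for every $F\in\widetilde{B_1}$. -/

import Mathlib

open Filter Topology

/-- The norm `N` on the complex algebra `A` is complete. An `AlgebraNorm ℂ A` is a
submultiplicative norm on `A` that is homogeneous over `ℂ`; together with completeness it is a
Banach algebra norm. -/
def IsCompleteNorm {A : Type*} [Ring A] [Algebra ℂ A] (N : AlgebraNorm ℂ A) : Prop :=
  ∀ u : ℕ → A,
    (∀ ε : ℝ, 0 < ε → ∃ n₀ : ℕ, ∀ m ≥ n₀, ∀ n ≥ n₀, N (u m - u n) < ε) →
      ∃ a : A, Tendsto (fun n => N (u n - a)) atTop (𝓝 0)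

/-- The point evaluation `f ↦ f x` as a character (unital multiplicative linear functional)
of the unital subalgebra `B` of `C(X)`. -/
noncomputable def pointEval {X : Type*} [TopologicalSpace X] (B : Subalgebra ℂ C(X, ℂ)) (x : X) :
    B →ₐ[ℂ] ℂ :=
  (ContinuousMap.evalAlgHom ℂ ℂ x).comp B.val

/-- `B` is natural: `x ↦ (f ↦ f x)` is a bijection of `X` onto the set of all characters of `B`,
which is the maximal ideal space of `B` (every character of a Banach algebra is continuous). -/
def IsNaturalAlgebra {X : Type*} [TopologicalSpace X] (B : Subalgebra ℂ C(X, ℂ)) : Prop :=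
  Function.Bijective (pointEval B)

/-- `B` is self-adjoint: it is natural and closed under complex conjugation. -/
def IsSelfAdjointAlgebra {X : Type*} [TopologicalSpace X] (B : Subalgebra ℂ C(X, ℂ)) : Prop :=
  IsNaturalAlgebra B ∧ ∀ f ∈ B, star f ∈ B

/-- The function `f ⊗ g` on `X × Y`, that is, `(x, y) ↦ f x * g y`. -/
noncomputable def tensorFun {X Y : Type*} [TopologicalSpace X] [TopologicalSpace Y]
    (f : C(X, ℂ)) (g : C(Y, ℂ)) : C(X × Y, ℂ) where
  toFun p := f p.1 * g p.2
  continuous_toFun := by fun_prop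

/-- The space `E ⊗ E'` of all finite sums of functions `f ⊗ g` with `f ∈ E` and `g ∈ E'`. -/
noncomputable def tensorSpace {X Y : Type*} [TopologicalSpace X] [TopologicalSpace Y]
    (E : Submodule ℂ C(X, ℂ)) (E' : Submodule ℂ C(Y, ℂ)) : Submodule ℂ C(X × Y, ℂ) :=
  Submodule.span ℂ {F | ∃ f ∈ E, ∃ g ∈ E', F = tensorFun f g}

universe u v w w₁ w₂

/-- `Bt`, with the norm `nBt`, is a natural `C(Y)`-valuezation of `B ⊆ C(X)`, where `B` carries the
norm `nB`. The compact Hausdorff space that the map `D` of the definition refers to may live in any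
universe `w`. -/
structure IsNaturalValuezation {X : Type u} {Y : Type v}
    [TopologicalSpace X] [CompactSpace X] [T2Space X]
    [TopologicalSpace Y] [CompactSpace Y] [T2Space Y]
    (B : Subalgebra ℂ C(X, ℂ)) (nB : AlgebraNorm ℂ B)
    (Bt : Subalgebra ℂ C(X × Y, ℂ)) (nBt : AlgebraNorm ℂ Bt) : Prop where
  complete_base : IsCompleteNorm nB
  separates_base : B.SeparatesPoints
  selfAdjoint_base : IsSelfAdjointAlgebra B
  complete : IsCompleteNorm nBt
  separates : Bt.SeparatesPoints
  selfAdjoint : IsSelfAdjointAlgebra Bt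
  tensor_le : tensorSpace (Subalgebra.toSubmodule B) (⊤ : Submodule ℂ C(Y, ℂ)) ≤
    Subalgebra.toSubmodule Bt
  exists_map : ∃ (M : Type w) (_ : TopologicalSpace M) (_ : CompactSpace M) (_ : T2Space M)
    (D : Bt →ₗ[ℂ] C(M, ℂ)),
      -- the kernel of `D` is `1 ⊗ C(Y)`
      (∀ F : Bt, D F = 0 ↔ ∃ g : C(Y, ℂ), (F : C(X × Y, ℂ)) = tensorFun 1 g) ∧
      -- `D` maps real-valued functions to real-valued functions
      (∀ F : Bt, (∀ p, ((F : C(X × Y, ℂ)) p).im = 0) → ∀ m, (D F m).im = 0) ∧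
      -- the norms on the right are the supremum norms on `X × Y` and on `M`
      (∀ F : Bt, nBt F = ‖(F : C(X × Y, ℂ))‖ + ‖D F‖)

/-!
A seminorm `d` vanishing on constants has the same directional derivatives at `G` and at
`G + (ρ - 1) • 1`. The supremum norm behaves differently: for a peak function `G` and `Re ρ > 1`,
its derivative at `G + (ρ - 1) • 1` is the support functional of the peak set of `G` in the
direction `conj ρ`. Varying `ρ` therefore separates the two parts of the norm `‖F‖ + d F`, which an
isometry `U` only preserves in sum.

Applied to preimages of peak functions, this shows that `U 1` is unimodular with `d (U 1) = 0`.
Division by `U 1` then makes `U` unital, and the same device shows that a unital isometry maps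
real functions to real functions with the same extrema over corresponding peak sets. Shrinking
the peak sets to a point exhibits `U` as composition with a homeomorphism, hence as isometric for
each of the two parts of the norm. Since `d` has kernel `1 ⊗ C(Y)`, the second coordinate of the
homeomorphism depends on `y` only.
-/

open scoped ComplexConjugate

section ComplexNumbers

theorem eq_of_forall_re_mul_le {u v : ℂ} (h : ∀ ζ, (u * ζ).re ≤ (v * ζ).re) : u = v := by
  have hre := h 1
  have hre' := h (-1)
  have him := h Complex.I
  have him' := h (-Complex.I)
  simp only [mul_one, mul_neg, Complex.neg_re, Complex.mul_I_re] at hre hre' him him'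
  exact Complex.ext (by linarith) (by linarith)

theorem eq_ofReal_of_norm_le {z : ℂ} {r : ℝ} (hnorm : ‖z‖ ≤ r) (hre : r ≤ z.re) : z = r := by
  have hz : z.re = ‖z‖ := z.re_le_norm.antisymm (hnorm.trans hre)
  have hr : z.re = r := (z.re_le_norm.trans hnorm).antisymm hre
  exact Complex.ext hr (Complex.nonneg_iff.1 (Complex.re_eq_norm.1 hz)).2.symm

theorem norm_add_mul_I_eq {x y r : ℝ} (hr : 0 ≤ r) (h : x ^ 2 + y ^ 2 = r ^ 2) :
    ‖(x + y * Complex.I : ℂ)‖ = r := by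
  rw [Complex.norm_add_mul_I, h, Real.sqrt_sq hr]

theorem norm_three_add_four_mul_I : ‖(3 + 4 * Complex.I : ℂ)‖ = 5 :=
  mod_cast norm_add_mul_I_eq (x := 3) (y := 4) (r := 5) (by norm_num) (by norm_num)

theorem four_mul_norm_le_of_rotation {u v : ℂ}
    (h : ‖(3 + 4 * Complex.I : ℂ)‖ * (conj 5 * u) =
      ‖(5 : ℂ)‖ * (conj (3 + 4 * Complex.I) * v)) : 4 * ‖v‖ ≤ 5 * ‖u - v‖ := by
  have hrot : 5 * (v - u) = (2 + 4 * Complex.I) * v := by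
    simp only [norm_three_add_four_mul_I, map_add, map_mul, Complex.conj_I, map_ofNat,
      Complex.norm_ofNat] at h
    push_cast at h
    linear_combination -h / 5
  have h4 : 4 ≤ ‖(2 + 4 * Complex.I : ℂ)‖ := by
    simpa using Complex.abs_im_le_norm (2 + 4 * Complex.I)
  rw [norm_sub_rev, ← Complex.norm_ofNat 5, ← norm_mul, hrot, norm_mul]
  gcongr

end ComplexNumbers

section DirectionalDerivative

variable {E : Type*} [AddCommGroup E] [Module ℂ E] (p : Seminorm ℂ E) (a w : E)

/-- The one-sided directional derivative of the seminorm `p` at `a` in the direction `w`. -/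
noncomputable def seminormDeriv : ℝ :=
  derivWithin (fun t : ℝ => p (a + (t : ℂ) • w)) (Set.Ioi 0) 0

theorem convexOn_seminorm_line : ConvexOn ℝ Set.univ fun t : ℝ => p (a + (t : ℂ) • w) := by
  refine ⟨convex_univ, fun s _ t _ α β hα hβ hαβ => ?_⟩
  have hcomb : a + ((α • s + β • t : ℝ) : ℂ) • w =
      (α : ℂ) • (a + (s : ℂ) • w) + (β : ℂ) • (a + (t : ℂ) • w) := by
    have hαβ' : (α : ℂ) + β = 1 := mod_cast hαβ
    simp only [smul_eq_mul, Complex.ofReal_add, Complex.ofReal_mul]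
    linear_combination (norm := module) (-hαβ') • a
  simp only [hcomb]
  refine (map_add_le_add p _ _).trans_eq ?_
  simp only [map_smul_eq_mul, Complex.norm_of_nonneg hα, Complex.norm_of_nonneg hβ, smul_eq_mul]

theorem hasDerivWithinAt_seminormDeriv :
    HasDerivWithinAt (fun t : ℝ => p (a + (t : ℂ) • w)) (seminormDeriv p a w) (Set.Ioi 0) 0 :=
  (convexOn_seminorm_line p a w).hasDerivWithinAt_rightDeriv_of_mem_interior (by simp)

variable {p a w}

theorem add_mul_seminormDeriv_le {t : ℝ} (ht : 0 < t) :
    p a + t * seminormDeriv p a w ≤ p (a + (t : ℂ) • w) := by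
  have hslope := (convexOn_seminorm_line p a w).rightDeriv_le_slope_of_mem_interior
    (x := 0) (y := t) (by simp) trivial ht
  simp only [slope_def_field, Complex.ofReal_zero, zero_smul, add_zero, sub_zero] at hslope
  rw [seminormDeriv]
  linarith [(le_div_iff₀' ht).1 hslope]

theorem le_seminormDeriv {c : ℝ} (h : ∀ t : ℝ, 0 < t → p a + t * c ≤ p (a + (t : ℂ) • w)) :
    c ≤ seminormDeriv p a w := by
  refine ge_of_tendsto ((hasDerivWithinAt_iff_tendsto_slope' (by simp)).1
    (hasDerivWithinAt_seminormDeriv p a w)) (eventually_mem_nhdsWithin.mono fun t ht => ?_)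
  have ht : 0 < t := ht
  simp only [slope_def_field, Complex.ofReal_zero, zero_smul, add_zero, sub_zero]
  rw [le_div_iff₀' ht]
  linarith [h t ht]

theorem seminormDeriv_le : seminormDeriv p a w ≤ p w := by
  have h := (add_mul_seminormDeriv_le (p := p) (a := a) (w := w) one_pos).trans
    (map_add_le_add p _ _)
  simpa using h

variable {e : E}

theorem seminorm_add_smul_of_eq_zero (he : p e = 0) (a : E) (z : ℂ) : p (a + z • e) = p a := by
  have hz : p (z • e) = 0 := by rw [map_smul_eq_mul, he, mul_zero]
  refine le_antisymm ((map_add_le_add p a _).trans_eq (by rw [hz, add_zero])) ?_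
  simpa only [add_sub_cancel_right, hz, add_zero] using map_sub_le_add p (a + z • e) (z • e)

theorem seminormDeriv_add_smul_left (he : p e = 0) (a w : E) (z : ℂ) :
    seminormDeriv p (a + z • e) w = seminormDeriv p a w := by
  simp only [seminormDeriv, add_right_comm a (z • e), seminorm_add_smul_of_eq_zero he]

theorem seminormDeriv_smul_of_eq_zero (he : p e = 0) (a : E) (z : ℂ) :
    seminormDeriv p a (z • e) = 0 := by
  simp only [seminormDeriv, smul_smul, seminorm_add_smul_of_eq_zero he, derivWithin_fun_const,
    Pi.zero_apply]

end DirectionalDerivative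

section SupNorm

variable {K : Type*} [TopologicalSpace K]

/-- The support functional of the subset `f(S)` of the plane, in the normalisation
`z ↦ sup {Re (z * f x) : x ∈ S}`; it is meaningful when `f(S)` is nonempty and bounded. -/
noncomputable def supportFun (f : C(K, ℂ)) (S : Set K) (z : ℂ) : ℝ :=
  sSup ((fun x => (z * f x).re) '' S)

theorem supportFun_smul (f : C(K, ℂ)) (S : Set K) (z ζ : ℂ) :
    supportFun (ζ • f) S z = supportFun f S (z * ζ) := by
  simp [supportFun, mul_assoc]

theorem supportFun_eq_of_eqOn {f : C(K, ℂ)} {S : Set K} {c : ℂ}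
    (hne : S.Nonempty) (hf : ∀ x ∈ S, f x = c) (z : ℂ) : supportFun f S z = (z * c).re := by
  have himage : (fun x => (z * f x).re) '' S = (fun _ => (z * c).re) '' S :=
    Set.image_congr fun x hx => by rw [hf x hx]
  rw [supportFun, himage, hne.image_const, csSup_singleton]

theorem supportFun_I_mul_eq_zero {f : C(K, ℂ)} {S : Set K}
    (hne : S.Nonempty) (hf : ∀ x, (f x).im = 0) (r : ℝ) :
    supportFun f S (r * Complex.I) = 0 := by
  have hzero : (fun x => (r * Complex.I * f x).re) '' S = (fun _ => 0) '' S :=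
    Set.image_congr fun x _ => by simp [mul_assoc, hf x]
  rw [supportFun, hzero, hne.image_const, csSup_singleton]

variable [CompactSpace K]

/-- The set of the points where `|f|` attains the supremum norm of `f`. -/
def maxModulusSet (f : C(K, ℂ)) : Set K :=
  {x | ‖f x‖ = ‖f‖}

/-- The one-sided directional derivative of the supremum norm. -/
noncomputable def supNormDeriv (f w : C(K, ℂ)) : ℝ :=
  seminormDeriv (normSeminorm ℂ C(K, ℂ)) f w

theorem isClosed_maxModulusSet (f : C(K, ℂ)) : IsClosed (maxModulusSet f) :=
  isClosed_eq (by fun_prop) continuous_const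

variable {f w : C(K, ℂ)} {x : K}

theorem sq_norm_add_mul_re_le (hx : x ∈ maxModulusSet f) (t : ℝ) :
    ‖f‖ ^ 2 + t * (conj (f x) * w x).re ≤ ‖f‖ * ‖f + (t : ℂ) • w‖ := by
  have hx : ‖f x‖ = ‖f‖ := hx
  calc ‖f‖ ^ 2 + t * (conj (f x) * w x).re
      = (conj (f x) * (f + (t : ℂ) • w) x).re := by
        simp only [← hx, Complex.sq_norm, Complex.normSq_apply, Complex.mul_re, Complex.conj_re,
          Complex.conj_im, ContinuousMap.add_apply, ContinuousMap.coe_smul, Pi.smul_apply,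
          Complex.real_smul, Complex.coe_smul, Complex.add_re, Complex.add_im, Complex.mul_im,
          Complex.ofReal_re, Complex.ofReal_im]
        ring
    _ ≤ ‖f x‖ * ‖(f + (t : ℂ) • w) x‖ :=
        (Complex.re_le_norm _).trans_eq (by rw [norm_mul, RCLike.norm_conj])
    _ ≤ ‖f‖ * ‖f + (t : ℂ) • w‖ := by
        rw [hx]
        gcongr
        exact ContinuousMap.norm_coe_le_norm _ x

theorem re_le_norm_mul_supNormDeriv (hx : x ∈ maxModulusSet f) :
    (conj (f x) * w x).re ≤ ‖f‖ * supNormDeriv f w := by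
  rcases eq_or_ne f 0 with rfl | hf
  · simp
  have hf : 0 < ‖f‖ := norm_pos_iff.2 hf
  rw [← div_le_iff₀' hf]
  refine le_seminormDeriv fun t _ => le_of_mul_le_mul_left ?_ hf
  simp only [coe_normSeminorm]
  refine (sq_norm_add_mul_re_le hx t).trans' (le_of_eq ?_)
  field_simp

theorem nonempty_maxModulusSet [Nonempty K] (f : C(K, ℂ)) : (maxModulusSet f).Nonempty := by
  obtain ⟨x, -, hx⟩ := isCompact_univ.exists_isMaxOn Set.univ_nonempty
    (f.continuous.norm.continuousOn)
  exact ⟨x, (f.norm_coe_le_norm x).antisymm ((f.norm_le (norm_nonneg _)).2 fun y => hx trivial)⟩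

/-- The projection of a closed subset of `ℝ × K` to `ℝ` is closed, so the points where
`f + t • w` attains its norm cluster as `t → 0` at a point with the asserted property. -/
theorem exists_norm_mul_supNormDeriv_le [Nonempty K] (f w : C(K, ℂ)) :
    ∃ x ∈ maxModulusSet f, ‖f‖ * supNormDeriv f w ≤ (conj (f x) * w x).re := by
  let g : ℝ → C(K, ℂ) := fun t => f + (t : ℂ) • w
  let Z : Set (ℝ × K) := {q | ‖g q.1 q.2‖ = ‖g q.1‖} ∩
    {q | ‖g q.1‖ * supNormDeriv f w ≤ (conj (g q.1 q.2) * w q.2).re}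
  have hg : Continuous g := by fun_prop
  have heval : Continuous fun q : ℝ × K => g q.1 q.2 := by
    simp only [g, ContinuousMap.add_apply, ContinuousMap.smul_apply]
    fun_prop
  have hZ : IsClosed Z :=
    (isClosed_eq (by fun_prop) (by fun_prop)).inter (isClosed_le (by fun_prop) (by fun_prop))
  have hpos : Set.Ioi 0 ⊆ Prod.fst '' Z := fun t ht => by
    have ht : 0 < t := ht
    obtain ⟨x, hx⟩ := nonempty_maxModulusSet (g t)
    refine ⟨(t, x), ⟨hx, ?_⟩, rfl⟩
    have hback := sq_norm_add_mul_re_le (w := w) hx (-t)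
    rw [show g t + ((-t : ℝ) : ℂ) • w = f by simp [g]] at hback
    have hforth : ‖f‖ + t * supNormDeriv f w ≤ ‖g t‖ :=
      add_mul_seminormDeriv_le (p := normSeminorm ℂ C(K, ℂ)) ht
    have := mul_le_mul_of_nonneg_left hforth (norm_nonneg (g t))
    exact le_of_mul_le_mul_left (by linarith) ht
  obtain ⟨⟨t, x⟩, ⟨hx, hle⟩, rfl : t = 0⟩ : (0 : ℝ) ∈ Prod.fst '' Z :=
    (isClosedMap_fst_of_compactSpace Z hZ).closure_subset_iff.2 hpos (by simp)
  exact ⟨x, by simpa [g, maxModulusSet] using hx, by simpa [g] using hle⟩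

theorem re_le_supportFun {S : Set K} (hx : x ∈ S) (z : ℂ) : (z * f x).re ≤ supportFun f S z := by
  have hbdd : BddAbove (Set.range fun x => (z * f x).re) :=
    (isCompact_range (by fun_prop)).bddAbove
  exact le_csSup (hbdd.mono (Set.image_subset_range _ _)) ⟨x, hx, rfl⟩

theorem exists_re_eq_supportFun {S : Set K} (hS : IsClosed S) (hne : S.Nonempty) (f : C(K, ℂ))
    (z : ℂ) : ∃ x ∈ S, (z * f x).re = supportFun f S z :=
  (hS.isCompact.image (by fun_prop)).sSup_mem (hne.image _)

theorem norm_mul_supNormDeriv_eq_supportFun [Nonempty K] {ρ : ℂ} (hf : f ≠ 0)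
    (hρ : ∀ x ∈ maxModulusSet f, ‖ρ‖ * f x = ‖f‖ * ρ) (w : C(K, ℂ)) :
    ‖ρ‖ * supNormDeriv f w = supportFun w (maxModulusSet f) (conj ρ) := by
  have hf : 0 < ‖f‖ := norm_pos_iff.2 hf
  have hre : ∀ x ∈ maxModulusSet f,
      ‖ρ‖ * (conj (f x) * w x).re = ‖f‖ * (conj ρ * w x).re := fun x hx => by
    have hconj := congrArg conj (hρ x hx)
    simp only [map_mul, Complex.conj_ofReal] at hconj
    rw [← Complex.re_ofReal_mul, ← Complex.re_ofReal_mul, ← mul_assoc, hconj, mul_assoc]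
  apply le_antisymm
  · obtain ⟨x, hx, hle⟩ := exists_norm_mul_supNormDeriv_le f w
    refine le_of_mul_le_mul_left ?_ hf
    calc ‖f‖ * (‖ρ‖ * supNormDeriv f w) = ‖ρ‖ * (‖f‖ * supNormDeriv f w) := by ring
      _ ≤ ‖ρ‖ * (conj (f x) * w x).re := by gcongr
      _ ≤ ‖f‖ * supportFun w (maxModulusSet f) (conj ρ) := by
        rw [hre x hx]
        gcongr
        exact re_le_supportFun hx _
  · obtain ⟨x, hx, hmax⟩ := exists_re_eq_supportFun (isClosed_maxModulusSet f)
      (nonempty_maxModulusSet f) w (conj ρ)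
    refine le_of_mul_le_mul_left ?_ hf
    calc ‖f‖ * supportFun w (maxModulusSet f) (conj ρ) = ‖ρ‖ * (conj (f x) * w x).re := by
          rw [hre x hx, hmax]
      _ ≤ ‖ρ‖ * (‖f‖ * supNormDeriv f w) := by
        gcongr
        exact re_le_norm_mul_supNormDeriv hx
      _ = ‖f‖ * (‖ρ‖ * supNormDeriv f w) := by ring

end SupNorm

section PeakFunction

variable {K : Type*} [TopologicalSpace K] {G : C(K, ℂ)} {ρ : ℂ}

/-- A peak function: a continuous function with real values in `[-1, 1]` that attains the value
`1`. Its peak set is `{x | G x = 1}`. -/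
structure IsPeakFunction (G : C(K, ℂ)) : Prop where
  exists_real : ∀ x, ∃ r ∈ Set.Icc (-1 : ℝ) 1, G x = r
  exists_eq_one : ∃ x, G x = 1

theorem isClosed_peakSet (G : C(K, ℂ)) : IsClosed {x | G x = 1} :=
  isClosed_eq (by fun_prop) continuous_const

theorem sq_norm_sub_sq_norm_add_sub_one (ρ : ℂ) (r : ℝ) :
    ‖ρ‖ ^ 2 - ‖(r + (ρ - 1) : ℂ)‖ ^ 2 = (1 - r) * (2 * ρ.re - 1 + r) := by
  simp only [Complex.sq_norm, Complex.normSq_apply, Complex.add_re, Complex.add_im,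
    Complex.sub_re, Complex.sub_im, Complex.ofReal_re, Complex.ofReal_im, Complex.one_re,
    Complex.one_im]
  ring

namespace IsPeakFunction

theorem norm_apply_add_le (hG : IsPeakFunction G) (hρ : 1 < ρ.re) (x : K) :
    ‖G x + (ρ - 1)‖ ≤ ‖ρ‖ := by
  obtain ⟨r, ⟨hr₁, hr₂⟩, hGr⟩ := hG.exists_real x
  have hsq := sq_norm_sub_sq_norm_add_sub_one ρ r
  rw [← sq_le_sq₀ (norm_nonneg _) (norm_nonneg _), hGr]
  nlinarith

theorem norm_apply_add_eq_iff (hG : IsPeakFunction G) (hρ : 1 < ρ.re) (x : K) :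
    ‖G x + (ρ - 1)‖ = ‖ρ‖ ↔ G x = 1 := by
  obtain ⟨r, ⟨hr₁, -⟩, hGr⟩ := hG.exists_real x
  rw [eq_comm, ← sq_eq_sq₀ (norm_nonneg _) (norm_nonneg _), ← sub_eq_zero, hGr,
    sq_norm_sub_sq_norm_add_sub_one, mul_eq_zero,
    or_iff_left (by linarith : 2 * ρ.re - 1 + r ≠ 0), sub_eq_zero, eq_comm, Complex.ofReal_eq_one]

variable [CompactSpace K]

theorem norm_add_smul_one (hG : IsPeakFunction G) (hρ : 1 < ρ.re) :
    ‖G + (ρ - 1) • (1 : C(K, ℂ))‖ = ‖ρ‖ := by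
  obtain ⟨x, hx⟩ := hG.exists_eq_one
  refine le_antisymm ((ContinuousMap.norm_le _ (norm_nonneg _)).2 fun y => ?_) ?_
  · simpa using hG.norm_apply_add_le hρ y
  · simpa [hx] using (G + (ρ - 1) • 1).norm_coe_le_norm x

theorem maxModulusSet_add_smul_one (hG : IsPeakFunction G) (hρ : 1 < ρ.re) :
    maxModulusSet (G + (ρ - 1) • 1) = {x | G x = 1} := by
  ext x
  simp [maxModulusSet, hG.norm_add_smul_one hρ, hG.norm_apply_add_eq_iff hρ x]

theorem add_smul_one_ne_zero (hG : IsPeakFunction G) (hρ : 1 < ρ.re) :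
    G + (ρ - 1) • (1 : C(K, ℂ)) ≠ 0 := by
  rw [← norm_pos_iff, hG.norm_add_smul_one hρ]
  exact (zero_lt_one.trans hρ).trans_le (Complex.re_le_norm ρ)

theorem norm_mul_supNormDeriv (hG : IsPeakFunction G) (hρ : 1 < ρ.re) (w : C(K, ℂ)) :
    ‖ρ‖ * supNormDeriv (G + (ρ - 1) • 1) w = supportFun w {x | G x = 1} (conj ρ) := by
  have : Nonempty K := hG.exists_eq_one.nonempty
  rw [← hG.maxModulusSet_add_smul_one hρ]
  refine norm_mul_supNormDeriv_eq_supportFun (hG.add_smul_one_ne_zero hρ) (fun x hx => ?_) w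
  rw [hG.maxModulusSet_add_smul_one hρ] at hx
  have hx : G x = 1 := hx
  simp [hG.norm_add_smul_one hρ, hx]

end IsPeakFunction

theorem exists_isPeakFunction [CompactSpace K] [T2Space K] {A : Subalgebra ℂ C(K, ℂ)}
    (hsep : A.SeparatesPoints) (hstar : ∀ f ∈ A, star f ∈ A) {W : Set K} (hW : IsOpen W)
    (hne : W.Nonempty) : ∃ G ∈ A, IsPeakFunction G ∧ {x | G x = 1} ⊆ W := by
  obtain ⟨p, hp⟩ := hne
  obtain ⟨e, he0, he1, he⟩ := exists_continuous_zero_one_of_isClosed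
    hW.isClosed_compl (isClosed_singleton (x := p)) (by simpa using hp)
  let S : StarSubalgebra ℂ C(K, ℂ) := { A with star_mem' := fun {f} => hstar f }
  obtain ⟨⟨g, hgA⟩, hge⟩ :=
    ContinuousMap.exists_mem_subalgebra_near_continuousMap_of_separatesPoints _
      (Subalgebra.SeparatesPoints.rclike_to_real (A := S) hsep) e (1 / 4) (by norm_num)
  have hge : ∀ x, |g x - e x| < 1 / 4 := fun x => ((g - e).norm_coe_le_norm x).trans_lt hge
  obtain ⟨x₀, -, hx₀⟩ := isCompact_univ.exists_isMaxOn ⟨p, Set.mem_univ p⟩ g.continuous.continuousOn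
  have hmax : ∀ x, g x ≤ g x₀ := fun x => hx₀ (Set.mem_univ x)
  have hlow : 3 / 4 < g x₀ := by
    have hep : e p = 1 := he1 rfl
    linarith [hmax p, (abs_lt.1 (hge p)).1]
  let G : C(K, ℂ) := (((g x₀)⁻¹ : ℝ) : ℂ) • ⟨fun x => (g x : ℂ), by fun_prop⟩
  have hG : ∀ x, G x = ((g x / g x₀ : ℝ) : ℂ) := fun x => by
    simp [G, div_eq_inv_mul]
  refine ⟨G, A.smul_mem hgA _, ⟨fun x => ⟨g x / g x₀, ⟨?_, ?_⟩, hG x⟩, x₀, ?_⟩, fun x hx => ?_⟩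
  · rw [le_div_iff₀ (by linarith)]
    linarith [(he x).1, (abs_lt.1 (hge x)).1]
  · rw [div_le_one₀ (by linarith)]
    exact hmax x
  · rw [hG, div_self (by linarith), Complex.ofReal_one]
  · by_contra hxW
    have hex : e x = 0 := he0 hxW
    rw [Set.mem_ofPred_eq, hG, Complex.ofReal_eq_one, div_eq_one_iff_eq (by linarith)] at hx
    linarith [(abs_lt.1 (hge x)).2]

end PeakFunction

section AugmentedIsometry

variable {K₁ K₂ : Type*} [TopologicalSpace K₁] [TopologicalSpace K₂]
  {A₁ : Subalgebra ℂ C(K₁, ℂ)} {A₂ : Subalgebra ℂ C(K₂, ℂ)}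
  {d₁ : Seminorm ℂ A₁} {d₂ : Seminorm ℂ A₂} {U : A₁ ≃ₗ[ℂ] A₂} {G : A₂} {ρ : ℂ} {a : A₁}

theorem map_add_smul_one (hU1 : U 1 = 1) (E : A₁) (z : ℂ) : U (E + z • 1) = U E + z • 1 := by
  rw [map_add U, map_smul U, hU1]

variable [CompactSpace K₂]

theorem ne_zero_of_map_eq_add_smul_one (hG : IsPeakFunction G.1) (hρ : 1 < ρ.re)
    (ha : U a = G + (ρ - 1) • 1) : a.1 ≠ 0 := fun h0 => hG.add_smul_one_ne_zero hρ <| by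
  have hUa : U a = 0 := by rw [show a = 0 from Subtype.ext h0, U.map_zero]
  exact congrArg Subtype.val (ha.symm.trans hUa)

variable [CompactSpace K₁]

theorem injective_of_norm_add_seminorm_eq {T : A₁ →ₗ[ℂ] A₂}
    (hT : ∀ F, ‖(T F).1‖ + d₂ (T F) = ‖F.1‖ + d₁ F) : Function.Injective T :=
  (injective_iff_map_eq_zero T).2 fun F hF => Subtype.ext <| norm_le_zero_iff.1 <| by
    have := hT F
    rw [hF, show d₂ 0 = 0 from d₂.map_zero', ZeroMemClass.coe_zero, norm_zero] at this
    linarith [apply_nonneg d₁ F]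

/-- The linear bijection `U` is isometric for the norms `‖F‖ + d₁ F` and `‖G‖ + d₂ G`, where `‖·‖`
is the supremum norm. -/
def IsAugmentedIsometry (d₁ : Seminorm ℂ A₁) (d₂ : Seminorm ℂ A₂) (U : A₁ ≃ₗ[ℂ] A₂) : Prop :=
  ∀ F : A₁, ‖(U F).1‖ + d₂ (U F) = ‖F.1‖ + d₁ F

namespace IsAugmentedIsometry

theorem symm (hU : IsAugmentedIsometry d₁ d₂ U) : IsAugmentedIsometry d₂ d₁ U.symm := fun G => by
  rw [← hU, U.apply_symm_apply]

theorem deriv_eq (hU : IsAugmentedIsometry d₁ d₂ U) (a w : A₁) :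
    supNormDeriv (U a).1 (U w).1 + seminormDeriv d₂ (U a) (U w) =
      supNormDeriv a.1 w.1 + seminormDeriv d₁ a w := by
  have h₁ := (hasDerivWithinAt_seminormDeriv (normSeminorm ℂ C(K₁, ℂ)) a.1 w.1).add
    (hasDerivWithinAt_seminormDeriv d₁ a w)
  have h₂ := (hasDerivWithinAt_seminormDeriv (normSeminorm ℂ C(K₂, ℂ)) (U a).1 (U w).1).add
    (hasDerivWithinAt_seminormDeriv d₂ (U a) (U w))
  have hline : ∀ t : ℝ, ‖(U a).1 + (t : ℂ) • (U w).1‖ + d₂ (U a + (t : ℂ) • U w) =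
      ‖a.1 + (t : ℂ) • w.1‖ + d₁ (a + (t : ℂ) • w) := fun t => by
    have h := hU (a + (t : ℂ) • w)
    rw [map_add U, map_smul U] at h
    exact h
  exact (uniqueDiffWithinAt_Ioi 0).eq_deriv _ (h₂.congr (fun t _ => (hline t).symm)
    (hline 0).symm) h₁

theorem supportFun_add (hU : IsAugmentedIsometry d₁ d₂ U) (hd₂ : d₂ 1 = 0)
    (hG : IsPeakFunction G.1) (hρ : 1 < ρ.re) (ha : U a = G + (ρ - 1) • 1) (w : A₁) :
    supportFun (U w).1 {x | G.1 x = 1} (conj ρ) + ‖ρ‖ * seminormDeriv d₂ G (U w) =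
      ‖ρ‖ * (supNormDeriv a.1 w.1 + seminormDeriv d₁ a w) := by
  rw [← hU.deriv_eq, ← hG.norm_mul_supNormDeriv hρ, ha, seminormDeriv_add_smul_left hd₂, mul_add]
  rfl

end IsAugmentedIsometry

end AugmentedIsometry

section MapOne

variable {K₁ K₂ : Type*} [TopologicalSpace K₁] [CompactSpace K₁] [Nonempty K₁]
  [TopologicalSpace K₂] [CompactSpace K₂]
  {A₁ : Subalgebra ℂ C(K₁, ℂ)} {A₂ : Subalgebra ℂ C(K₂, ℂ)}
  {d₁ : Seminorm ℂ A₁} {d₂ : Seminorm ℂ A₂} {U : A₁ ≃ₗ[ℂ] A₂}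
  {G : A₂} {ρ σ : ℂ} {a : A₁}

namespace IsAugmentedIsometry

theorem norm_map_one_add (hU : IsAugmentedIsometry d₁ d₂ U) (hd₁ : d₁ 1 = 0) :
    ‖(U 1).1‖ + d₂ (U 1) = 1 := by
  rw [hU, hd₁, add_zero]
  exact norm_one

theorem phase_of_mem_maxModulusSet (hU : IsAugmentedIsometry d₁ d₂ U) (hd₁ : d₁ 1 = 0)
    (hd₂ : d₂ 1 = 0) (hG : IsPeakFunction G.1) (hρ : 1 < ρ.re) (ha : U a = G + (ρ - 1) • 1)
    {q : K₁} (hq : q ∈ maxModulusSet a.1) :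
    (∃ x, G.1 x = 1 ∧ conj ρ * (a.1 q * (U 1).1 x) = ‖ρ‖ * (‖a.1‖ * ‖(U 1).1‖)) ∧
      seminormDeriv d₂ G (a.1 q • U 1) = ‖a.1‖ * (1 - ‖(U 1).1‖) := by
  have hq' : ‖a.1 q‖ = ‖a.1‖ := hq
  have ha0 : 0 < ‖a.1‖ := norm_pos_iff.2 (ne_zero_of_map_eq_add_smul_one hG hρ ha)
  have hρ0 : 0 < ‖ρ‖ := (zero_lt_one.trans hρ).trans_le (Complex.re_le_norm ρ)
  obtain ⟨x, hx, hmax⟩ := exists_re_eq_supportFun (isClosed_peakSet G.1) hG.exists_eq_one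
    (U (a.1 q • 1)).1 (conj ρ)
  have hderiv := hU.supportFun_add hd₂ hG hρ ha (a.1 q • 1)
  rw [seminormDeriv_smul_of_eq_zero hd₁, add_zero, ← hmax, map_smul] at hderiv
  have hlow : ‖a.1‖ ≤ supNormDeriv a.1 (a.1 q • 1) := by
    have := re_le_norm_mul_supNormDeriv (w := a.1 q • 1) hq
    refine le_of_mul_le_mul_left (this.trans_eq' ?_) ha0
    simp [← hq', ← Complex.normSq_eq_norm_sq, Complex.normSq_apply, ← sq]
  have hpeak : ‖conj ρ * (a.1 q * (U 1).1 x)‖ ≤ ‖ρ‖ * (‖a.1‖ * ‖(U 1).1‖) := by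
    rw [norm_mul, norm_mul, RCLike.norm_conj, hq']
    gcongr
    exact ContinuousMap.norm_coe_le_norm _ x
  have hsemi : seminormDeriv d₂ G (a.1 q • U 1) ≤ ‖a.1‖ * (1 - ‖(U 1).1‖) := by
    refine seminormDeriv_le.trans_eq ?_
    rw [map_smul_eq_mul, hq', ← hU.norm_map_one_add hd₁, add_sub_cancel_left]
  have hlow' := mul_le_mul_of_nonneg_left hlow hρ0.le
  have hsemi' := mul_le_mul_of_nonneg_left hsemi hρ0.le
  have hpeak' := (Complex.re_le_norm _).trans hpeak
  have hderiv : (conj ρ * (a.1 q * (U 1).1 x)).re + ‖ρ‖ * seminormDeriv d₂ G (a.1 q • U 1) =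
    ‖ρ‖ * supNormDeriv a.1 (a.1 q • 1) := hderiv
  refine ⟨⟨x, hx, ?_⟩, hsemi.antisymm (le_of_mul_le_mul_left ?_ hρ0)⟩
  · exact_mod_cast eq_ofReal_of_norm_le hpeak (by linarith)
  · linarith

theorem norm_map_one_apply [T2Space K₂] (hU : IsAugmentedIsometry d₁ d₂ U) (hd₁ : d₁ 1 = 0)
    (hd₂ : d₂ 1 = 0) (hsep : A₂.SeparatesPoints) (hstar : ∀ f ∈ A₂, star f ∈ A₂) (x : K₂) :
    ‖(U 1).1 x‖ = ‖(U 1).1‖ := by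
  have hdense : Dense (maxModulusSet (U 1).1) := dense_iff_inter_open.2 fun W hW hne => by
    obtain ⟨G, hGA, hG, hGW⟩ := exists_isPeakFunction hsep hstar hW hne
    let a : A₁ := U.symm (⟨G, hGA⟩ + ((2 : ℂ) - 1) • 1)
    have ha : U a = ⟨G, hGA⟩ + ((2 : ℂ) - 1) • 1 := U.apply_symm_apply _
    obtain ⟨q, hq⟩ := nonempty_maxModulusSet a.1
    obtain ⟨⟨y, hy, hphase⟩, -⟩ :=
      hU.phase_of_mem_maxModulusSet hd₁ hd₂ hG (by norm_num) ha hq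
    refine ⟨y, hGW hy, ?_⟩
    have hnorm := congrArg norm hphase
    have hq : ‖a.1 q‖ = ‖a.1‖ := hq
    have ha0 : ‖a.1‖ ≠ 0 := norm_ne_zero_iff.2 (ne_zero_of_map_eq_add_smul_one hG (by norm_num) ha)
    simpa [maxModulusSet, hq, ha0] using hnorm
  exact (isClosed_maxModulusSet (U 1).1).closure_subset (hdense x)

theorem exists_mul_supNormDeriv_smul_one_le (hU : IsAugmentedIsometry d₁ d₂ U) (hd₁ : d₁ 1 = 0)
    (hd₂ : d₂ 1 = 0) (hG : IsPeakFunction G.1) (hρ : 1 < ρ.re) (ha : U a = G + (ρ - 1) • 1)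
    (ζ : ℂ) : ∃ x, G.1 x = 1 ∧
      ‖ρ‖ * ‖(U 1).1‖ * supNormDeriv a.1 (ζ • 1) ≤ (conj ρ * (ζ * (U 1).1 x)).re := by
  have ha0 : 0 < ‖a.1‖ := norm_pos_iff.2 (ne_zero_of_map_eq_add_smul_one hG hρ ha)
  obtain ⟨q, hq, hle⟩ := exists_norm_mul_supNormDeriv_le a.1 (ζ • 1)
  obtain ⟨⟨x, hx, hphase⟩, -⟩ := hU.phase_of_mem_maxModulusSet hd₁ hd₂ hG hρ ha hq
  have hq : ‖a.1 q‖ = ‖a.1‖ := hq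
  have hconj : ‖ρ‖ * ‖(U 1).1‖ * conj (a.1 q) = ‖a.1‖ * (conj ρ * (U 1).1 x) := by
    refine mul_left_cancel₀ (Complex.ofReal_ne_zero.2 ha0.ne') ?_
    have hsq : conj (a.1 q) * a.1 q = ‖a.1‖ ^ 2 := by rw [Complex.conj_mul', hq]
    linear_combination (-conj (a.1 q)) * hphase + conj ρ * (U 1).1 x * hsq
  refine ⟨x, hx, le_of_mul_le_mul_left ?_ ha0⟩
  calc ‖a.1‖ * (‖ρ‖ * ‖(U 1).1‖ * supNormDeriv a.1 (ζ • 1))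
      = ‖ρ‖ * ‖(U 1).1‖ * (‖a.1‖ * supNormDeriv a.1 (ζ • 1)) := by ring
    _ ≤ ‖ρ‖ * ‖(U 1).1‖ * (conj (a.1 q) * (ζ • (1 : C(K₁, ℂ))) q).re := by gcongr
    _ = (‖ρ‖ * ‖(U 1).1‖ * conj (a.1 q) * ζ).re := by
        rw [mul_assoc (_ * _ : ℂ), ← Complex.ofReal_mul, Complex.re_ofReal_mul]
        simp
    _ = ‖a.1‖ * (conj ρ * (ζ * (U 1).1 x)).re := by
        rw [hconj, mul_assoc, Complex.re_ofReal_mul]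
        ring_nf

theorem rotation_of_norm_map_one_lt_one (hU : IsAugmentedIsometry d₁ d₂ U) (hd₁ : d₁ 1 = 0)
    (hd₂ : d₂ 1 = 0) (hlt : ‖(U 1).1‖ < 1) (hG : IsPeakFunction G.1) (hρ : 1 < ρ.re)
    (hσ : 1 < σ.re) :
    ∃ x y, G.1 x = 1 ∧ G.1 y = 1 ∧
      ‖σ‖ * (conj ρ * (U 1).1 x) = ‖ρ‖ * (conj σ * (U 1).1 y) := by
  let a : A₁ := U.symm (G + (ρ - 1) • 1)
  have ha : U a = G + (ρ - 1) • 1 := U.apply_symm_apply _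
  let b : A₁ := U.symm (G + (σ - 1) • 1)
  have hb : U b = G + (σ - 1) • 1 := U.apply_symm_apply _
  obtain ⟨q, hq⟩ := nonempty_maxModulusSet a.1
  obtain ⟨⟨x, hx, hphase⟩, hsemi⟩ := hU.phase_of_mem_maxModulusSet hd₁ hd₂ hG hρ ha hq
  obtain ⟨y, hy, hle⟩ := hU.exists_mul_supNormDeriv_smul_one_le hd₁ hd₂ hG hσ hb (a.1 q)
  have hq : ‖a.1 q‖ = ‖a.1‖ := hq
  have hderiv : supportFun (a.1 q • U 1).1 {x | G.1 x = 1} (conj σ) +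
      ‖σ‖ * (‖a.1‖ * (1 - ‖(U 1).1‖)) = ‖σ‖ * supNormDeriv b.1 (a.1 q • 1) := by
    have := hU.supportFun_add hd₂ hG hσ hb (a.1 q • 1)
    rwa [seminormDeriv_smul_of_eq_zero hd₁, add_zero, map_smul, hsemi] at this
  have hlow : (conj σ * (a.1 q * (U 1).1 y)).re ≤
      supportFun (a.1 q • U 1).1 {x | G.1 x = 1} (conj σ) :=
    re_le_supportFun (f := (a.1 q • U 1).1) hy _
  have hre : ‖σ‖ * (‖a.1‖ * ‖(U 1).1‖) ≤ (conj σ * (a.1 q * (U 1).1 y)).re := by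
    have := mul_le_mul_of_nonneg_left (hlow.trans_eq (eq_sub_of_add_eq hderiv))
      (norm_nonneg (U 1).1)
    refine le_of_mul_le_mul_left ?_ (sub_pos.2 hlt)
    linarith
  have hnorm : ‖conj σ * (a.1 q * (U 1).1 y)‖ ≤ ‖σ‖ * (‖a.1‖ * ‖(U 1).1‖) := by
    rw [norm_mul, norm_mul, RCLike.norm_conj, hq]
    gcongr
    exact (U 1).1.norm_coe_le_norm y
  have heq := eq_ofReal_of_norm_le hnorm hre
  push_cast at heq
  have hq0 : a.1 q ≠ 0 := by
    rw [← norm_ne_zero_iff, hq, norm_ne_zero_iff]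
    exact ne_zero_of_map_eq_add_smul_one hG hρ ha
  refine ⟨x, y, hx, hy, mul_left_cancel₀ hq0 ?_⟩
  linear_combination (‖σ‖ : ℂ) * hphase - ‖ρ‖ * heq

theorem norm_map_one [T2Space K₂] [Nonempty K₂] (hU : IsAugmentedIsometry d₁ d₂ U) (hd₁ : d₁ 1 = 0)
    (hd₂ : d₂ 1 = 0) (hsep : A₂.SeparatesPoints) (hstar : ∀ f ∈ A₂, star f ∈ A₂) :
    ‖(U 1).1‖ = 1 := by
  have hsum := hU.norm_map_one_add hd₁
  refine le_antisymm (by linarith [apply_nonneg d₂ (U 1)]) (not_lt.1 fun hlt => ?_)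
  have hpos : 0 < ‖(U 1).1‖ := norm_pos_iff.2 fun h0 => by
    have h1 : (1 : A₁) = 0 := U.map_eq_zero_iff.1 (Subtype.ext h0)
    exact one_ne_zero (congrArg Subtype.val h1)
  obtain ⟨p⟩ := ‹Nonempty K₂›
  let W : Set K₂ := {x | ‖(U 1).1 x - (U 1).1 p‖ < ‖(U 1).1‖ / 3}
  have hW : IsOpen W := isOpen_lt (by fun_prop) continuous_const
  obtain ⟨G, hGA, hG, hGW⟩ := exists_isPeakFunction hsep hstar hW ⟨p, by simp [W, hpos]⟩
  obtain ⟨x, y, hx, hy, hxy⟩ := hU.rotation_of_norm_map_one_lt_one (G := ⟨G, hGA⟩) (ρ := 5)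
    (σ := 3 + 4 * Complex.I) hd₁ hd₂ hlt hG (by norm_num) (by norm_num)
  have hclose : ‖(U 1).1 x - (U 1).1 y‖ < ‖(U 1).1‖ / 3 + ‖(U 1).1‖ / 3 := by
    have hxW : ‖(U 1).1 x - (U 1).1 p‖ < ‖(U 1).1‖ / 3 := hGW hx
    have hyW : ‖(U 1).1 y - (U 1).1 p‖ < ‖(U 1).1‖ / 3 := hGW hy
    rw [norm_sub_rev] at hyW
    exact (norm_sub_le_norm_sub_add_norm_sub _ _ _).trans_lt (add_lt_add hxW hyW)
  have hfar : 4 * ‖(U 1).1‖ ≤ 5 * ‖(U 1).1 x - (U 1).1 y‖ := by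
    rw [← hU.norm_map_one_apply hd₁ hd₂ hsep hstar y]
    exact four_mul_norm_le_of_rotation hxy
  linarith

end IsAugmentedIsometry

end MapOne

section UnitalMap

variable {K₁ K₂ : Type*} [TopologicalSpace K₁] [CompactSpace K₁]
  [TopologicalSpace K₂] [CompactSpace K₂]
  {A₁ : Subalgebra ℂ C(K₁, ℂ)} {A₂ : Subalgebra ℂ C(K₂, ℂ)}
  {d₁ : Seminorm ℂ A₁} {d₂ : Seminorm ℂ A₂} {U : A₁ ≃ₗ[ℂ] A₂} {E : A₁} {ρ : ℂ}

namespace IsAugmentedIsometry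

theorem norm_add_smul_one (hU : IsAugmentedIsometry d₁ d₂ U) (hd₁ : d₁ 1 = 0) (hd₂ : d₂ 1 = 0)
    (hU1 : U 1 = 1) (hE : IsPeakFunction (U E).1) (hρ : 1 < ρ.re) :
    ‖(E + (ρ - 1) • 1).1‖ = ‖ρ‖ - (d₁ E - d₂ (U E)) := by
  have h := hU (E + (ρ - 1) • 1)
  have hpeak : ‖(U E + (ρ - 1) • 1).1‖ = ‖ρ‖ := hE.norm_add_smul_one hρ
  rw [map_add_smul_one hU1, seminorm_add_smul_of_eq_zero hd₁, seminorm_add_smul_of_eq_zero hd₂,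
    hpeak] at h
  linarith

theorem norm_mul_apply_of_mem_maxModulusSet (hU : IsAugmentedIsometry d₁ d₂ U) (hd₁ : d₁ 1 = 0)
    (hd₂ : d₂ 1 = 0) (hU1 : U 1 = 1) (hE : IsPeakFunction (U E).1) (hρ : 1 < ρ.re) {q : K₁}
    (hq : q ∈ maxModulusSet (E + (ρ - 1) • 1).1) :
    ‖ρ‖ * (E + (ρ - 1) • 1).1 q = ‖(E + (ρ - 1) • 1).1‖ * ρ := by
  set a : A₁ := E + (ρ - 1) • 1
  have hderiv (ζ : ℂ) : ‖ρ‖ * supNormDeriv a.1 (ζ • 1) = (conj ρ * ζ).re := by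
    have h := hU.supportFun_add hd₂ hE hρ (map_add_smul_one hU1 E _) (ζ • 1)
    have hconst : supportFun (ζ • (1 : A₂)).1 {x | (U E).1 x = 1} (conj ρ) = (conj ρ * ζ).re :=
      supportFun_eq_of_eqOn hE.exists_eq_one (fun x _ => mul_one ζ) _
    rw [map_smul U, hU1, seminormDeriv_smul_of_eq_zero hd₁, seminormDeriv_smul_of_eq_zero hd₂,
      mul_zero, add_zero, add_zero, hconst] at h
    exact h.symm
  have hle (ζ : ℂ) : (‖ρ‖ * conj (a.1 q) * ζ).re ≤ (‖a.1‖ * conj ρ * ζ).re := by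
    rw [mul_assoc, mul_assoc, Complex.re_ofReal_mul, Complex.re_ofReal_mul, ← hderiv,
      mul_left_comm]
    refine mul_le_mul_of_nonneg_left ?_ (norm_nonneg ρ)
    simpa using re_le_norm_mul_supNormDeriv (w := ζ • 1) hq
  simpa using congrArg conj (eq_of_forall_re_mul_le hle)

variable [Nonempty K₁]

theorem norm_mul_supNormDeriv_preimage (hU : IsAugmentedIsometry d₁ d₂ U) (hd₁ : d₁ 1 = 0)
    (hd₂ : d₂ 1 = 0) (hU1 : U 1 = 1) (hE : IsPeakFunction (U E).1) (hρ : 1 < ρ.re)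
    (w : C(K₁, ℂ)) :
    ‖ρ‖ * supNormDeriv (E + (ρ - 1) • 1).1 w =
      supportFun w (maxModulusSet (E + (ρ - 1) • 1).1) (conj ρ) :=
  norm_mul_supNormDeriv_eq_supportFun
    (ne_zero_of_map_eq_add_smul_one hE hρ (map_add_smul_one hU1 E _))
    (fun _ => hU.norm_mul_apply_of_mem_maxModulusSet hd₁ hd₂ hU1 hE hρ) w

/-- The derivatives of `d₁` at `E + (ρ - 1) • 1` and of `d₂` at its image do not depend on `ρ`, so
they cancel when `ρ` is turned by a quarter of a circle. -/
theorem supportFun_sub_supportFun_I_mul (hU : IsAugmentedIsometry d₁ d₂ U) (hd₁ : d₁ 1 = 0)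
    (hd₂ : d₂ 1 = 0) (hU1 : U 1 = 1) (hE : IsPeakFunction (U E).1) (hρ : 1 < ρ.re)
    (hρ' : 1 < ρ.im) (w : A₁) (β : ℂ) :
    supportFun (U w).1 {x | (U E).1 x = 1} β -
        supportFun (U w).1 {x | (U E).1 x = 1} (Complex.I * β) =
      supportFun w.1 (maxModulusSet (E + (ρ - 1) • 1).1) β -
        supportFun w.1 (maxModulusSet (E + (-Complex.I * ρ - 1) • 1).1) (Complex.I * β) := by
  have hρ0 : conj ρ ≠ 0 := by
    rw [map_ne_zero]
    rintro rfl
    simp only [Complex.zero_re] at hρ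
    linarith
  have hshift {σ : ℂ} (hσ : 1 < σ.re) (v : A₁) :
      supportFun (U v).1 {x | (U E).1 x = 1} (conj σ) + ‖σ‖ * seminormDeriv d₂ (U E) (U v) =
        supportFun v.1 (maxModulusSet (E + (σ - 1) • 1).1) (conj σ) +
          ‖σ‖ * seminormDeriv d₁ E v := by
    rw [hU.supportFun_add hd₂ hE hσ (map_add_smul_one hU1 E _), mul_add,
      hU.norm_mul_supNormDeriv_preimage hd₁ hd₂ hU1 hE hσ, seminormDeriv_add_smul_left hd₁]
  have h := hshift hρ ((β / conj ρ) • w)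
  have h' := hshift (σ := -Complex.I * ρ) (by simpa using hρ') ((β / conj ρ) • w)
  simp only [map_smul, SetLike.val_smul, supportFun_smul, map_mul, map_neg, Complex.conj_I,
    neg_neg, norm_mul, norm_neg, Complex.norm_I, one_mul, mul_assoc,
    mul_div_cancel₀ β hρ0] at h h'
  linarith

theorem seminorm_eq_of_isPeakFunction (hU : IsAugmentedIsometry d₁ d₂ U) (hd₁ : d₁ 1 = 0)
    (hd₂ : d₂ 1 = 0) (hU1 : U 1 = 1) (hE : IsPeakFunction (U E).1)
    (hstar : ∀ f ∈ A₁, star f ∈ A₁) : d₁ E = d₂ (U E) := by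
  set r : ℝ := d₁ E - d₂ (U E) with hr
  let w : A₁ := ⟨star E.1, hstar _ E.2⟩
  have hvalue {ρ : ℂ} (hρ : 1 < ρ.re) (z : ℂ) :
      supportFun w.1 (maxModulusSet (E + (ρ - 1) • 1).1) z = (z * (1 - r / ‖ρ‖ * conj ρ)).re := by
    refine supportFun_eq_of_eqOn (nonempty_maxModulusSet _) (fun q hq => ?_) z
    have hρ0 : (‖ρ‖ : ℂ) ≠ 0 :=
      mod_cast ((zero_lt_one.trans hρ).trans_le (Complex.re_le_norm ρ)).ne'
    have h := hU.norm_mul_apply_of_mem_maxModulusSet hd₁ hd₂ hU1 hE hρ hq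
    rw [hU.norm_add_smul_one hd₁ hd₂ hU1 hE hρ, ← hr] at h
    have h : ‖ρ‖ * (E.1 q + (ρ - 1) * 1) = ((‖ρ‖ - r : ℝ) : ℂ) * ρ := h
    have hEq : E.1 q = 1 - r / ‖ρ‖ * ρ := by
      field_simp
      push_cast at h
      linear_combination h
    simp [w, hEq]
  have hturn {ρ : ℂ} (hρ : 1 < ρ.re) (hρ' : 1 < ρ.im) :
      supportFun (U w).1 {x | (U E).1 x = 1} 1 -
        supportFun (U w).1 {x | (U E).1 x = 1} Complex.I = 1 - 2 * (r / ‖ρ‖ * ρ.re) := by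
    have h := hU.supportFun_sub_supportFun_I_mul hd₁ hd₂ hU1 hE hρ hρ' w 1
    rw [hvalue hρ, hvalue (by simpa using hρ'), mul_one, ← Complex.ofReal_div] at h
    rw [h]
    simp only [one_mul, neg_mul, norm_neg, norm_mul, Complex.norm_I, ← Complex.ofReal_div,
      map_neg, map_mul, Complex.conj_I, neg_neg, Complex.sub_re, Complex.sub_im, Complex.one_re,
      Complex.one_im, Complex.mul_re, Complex.mul_im, Complex.ofReal_re, Complex.ofReal_im,
      Complex.conj_re, Complex.conj_im, Complex.I_re, Complex.I_im]
    ring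
  have h₁ := hturn (ρ := 3 + 4 * Complex.I) (by norm_num) (by norm_num)
  have h₂ := hturn (ρ := 4 + 3 * Complex.I) (by norm_num) (by norm_num)
  rw [h₁] at h₂
  have hnorm : ‖(4 + 3 * Complex.I : ℂ)‖ = 5 :=
    mod_cast norm_add_mul_I_eq (x := 4) (y := 3) (r := 5) (by norm_num) (by norm_num)
  rw [norm_three_add_four_mul_I, hnorm] at h₂
  norm_num at h₂
  linarith

theorem maxModulusSet_preimage (hU : IsAugmentedIsometry d₁ d₂ U) (hd₁ : d₁ 1 = 0)
    (hd₂ : d₂ 1 = 0) (hU1 : U 1 = 1) (hE : IsPeakFunction (U E).1)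
    (hstar : ∀ f ∈ A₁, star f ∈ A₁) (hρ : 1 < ρ.re) :
    maxModulusSet (E + (ρ - 1) • 1).1 = {x | E.1 x = 1} := by
  have hnorm : ‖(E + (ρ - 1) • 1).1‖ = ‖ρ‖ := by
    rw [hU.norm_add_smul_one hd₁ hd₂ hU1 hE hρ,
      hU.seminorm_eq_of_isPeakFunction hd₁ hd₂ hU1 hE hstar, sub_self, sub_zero]
  have happly (q : K₁) : (E + (ρ - 1) • 1).1 q = E.1 q + (ρ - 1) * 1 := rfl
  ext q
  refine ⟨fun hq => ?_, fun hq => ?_⟩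
  · have hρ0 : (‖ρ‖ : ℂ) ≠ 0 :=
      mod_cast ((zero_lt_one.trans hρ).trans_le (Complex.re_le_norm ρ)).ne'
    have h := hU.norm_mul_apply_of_mem_maxModulusSet hd₁ hd₂ hU1 hE hρ hq
    rw [hnorm] at h
    have h := mul_left_cancel₀ hρ0 h
    rw [happly] at h
    change E.1 q = 1
    linear_combination h
  · have hq : E.1 q = 1 := hq
    change ‖(E + (ρ - 1) • 1).1 q‖ = _
    rw [hnorm, happly, hq, mul_one, add_sub_cancel]

theorem nonempty_preimage_peakSet (hU : IsAugmentedIsometry d₁ d₂ U) (hd₁ : d₁ 1 = 0)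
    (hd₂ : d₂ 1 = 0) (hU1 : U 1 = 1) (hE : IsPeakFunction (U E).1)
    (hstar : ∀ f ∈ A₁, star f ∈ A₁) : {x | E.1 x = 1}.Nonempty := by
  rw [← hU.maxModulusSet_preimage (ρ := 2) hd₁ hd₂ hU1 hE hstar (by norm_num)]
  exact nonempty_maxModulusSet _

theorem supportFun_sub_supportFun_I_mul_peakSet (hU : IsAugmentedIsometry d₁ d₂ U) (hd₁ : d₁ 1 = 0)
    (hd₂ : d₂ 1 = 0) (hU1 : U 1 = 1) (hE : IsPeakFunction (U E).1)
    (hstar : ∀ f ∈ A₁, star f ∈ A₁) (w : A₁) (β : ℂ) :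
    supportFun (U w).1 {x | (U E).1 x = 1} β -
        supportFun (U w).1 {x | (U E).1 x = 1} (Complex.I * β) =
      supportFun w.1 {x | E.1 x = 1} β - supportFun w.1 {x | E.1 x = 1} (Complex.I * β) := by
  rw [hU.supportFun_sub_supportFun_I_mul (ρ := 2 + 2 * Complex.I) hd₁ hd₂ hU1 hE (by norm_num)
      (by norm_num), hU.maxModulusSet_preimage hd₁ hd₂ hU1 hE hstar (by norm_num),
    hU.maxModulusSet_preimage hd₁ hd₂ hU1 hE hstar (by norm_num)]

end IsAugmentedIsometry

end UnitalMap

section SeparatingSubalgebra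

variable {K T : Type*} [TopologicalSpace K] [TopologicalSpace T] {A : Subalgebra ℂ C(K, ℂ)}

theorem eq_of_forall_apply_eq (hsep : A.SeparatesPoints) {x y : K}
    (h : ∀ F : A, F.1 x = F.1 y) : x = y := by
  by_contra hne
  obtain ⟨-, ⟨f, hf, rfl⟩, hfxy⟩ := hsep hne
  exact hfxy (h ⟨f, hf⟩)

theorem continuous_of_forall_comp [CompactSpace K] (hsep : A.SeparatesPoints) {σ : T → K}
    (hσ : ∀ F : A, Continuous fun p => F.1 (σ p)) : Continuous σ := by
  let eval : K → A → ℂ := fun x F => F.1 x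
  have heval : Continuous eval := continuous_pi fun F => F.1.continuous
  have hinj : Function.Injective eval := fun x y hxy => eq_of_forall_apply_eq hsep (congrFun hxy)
  exact (heval.isClosedEmbedding hinj).isInducing.continuous_iff.2 (continuous_pi hσ)

theorem norm_mul_of_forall_norm_eq_one [CompactSpace K] {u : C(K, ℂ)} (hu : ∀ x, ‖u x‖ = 1)
    (f : C(K, ℂ)) : ‖u * f‖ = ‖f‖ := by
  simp [ContinuousMap.norm_eq_iSup_norm, hu]

theorem exists_real_add_I_smul_real (hstar : ∀ f ∈ A, star f ∈ A) (F : A) :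
    ∃ P Q : A, (∀ x, (P.1 x).im = 0) ∧ (∀ x, (Q.1 x).im = 0) ∧ F = P + Complex.I • Q := by
  let S : A := ⟨star F.1, hstar _ F.2⟩
  refine ⟨(2⁻¹ : ℂ) • (F + S), (-Complex.I / 2) • (F - S), fun x => by simp [S],
    fun x => by simp [S], Subtype.ext (ContinuousMap.ext fun x => ?_)⟩
  simp only [Subalgebra.coe_add, Subalgebra.coe_smul, Subalgebra.coe_sub,
    ContinuousMap.add_apply, ContinuousMap.smul_apply, ContinuousMap.sub_apply, smul_eq_mul]
  linear_combination (1 / 2 * (F.1 x - S.1 x)) * Complex.I_mul_I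

end SeparatingSubalgebra

section UnitalComposition

variable {K₁ K₂ : Type*} [TopologicalSpace K₁] [CompactSpace K₁] [Nonempty K₁]
  [TopologicalSpace K₂] [CompactSpace K₂]
  {A₁ : Subalgebra ℂ C(K₁, ℂ)} {A₂ : Subalgebra ℂ C(K₂, ℂ)}
  {d₁ : Seminorm ℂ A₁} {d₂ : Seminorm ℂ A₂} {U : A₁ ≃ₗ[ℂ] A₂} {E F : A₁}

namespace IsAugmentedIsometry

theorem supportFun_eq_of_real (hU : IsAugmentedIsometry d₁ d₂ U) (hd₁ : d₁ 1 = 0)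
    (hd₂ : d₂ 1 = 0) (hU1 : U 1 = 1) (hE : IsPeakFunction (U E).1)
    (hstar : ∀ f ∈ A₁, star f ∈ A₁) (hF : ∀ x, (F.1 x).im = 0) :
    supportFun (U F).1 {x | (U E).1 x = 1} Complex.I =
        supportFun (U F).1 {x | (U E).1 x = 1} (-Complex.I) ∧
      supportFun (U F).1 {x | (U E).1 x = 1} 1 - supportFun (U F).1 {x | (U E).1 x = 1} Complex.I =
        supportFun F.1 {x | E.1 x = 1} 1 ∧
      supportFun (U F).1 {x | (U E).1 x = 1} (-1) -
          supportFun (U F).1 {x | (U E).1 x = 1} (-Complex.I) =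
        supportFun F.1 {x | E.1 x = 1} (-1) := by
  have hne := hU.nonempty_preimage_peakSet hd₁ hd₂ hU1 hE hstar
  have hturn := hU.supportFun_sub_supportFun_I_mul_peakSet hd₁ hd₂ hU1 hE hstar F
  have hI : supportFun F.1 {x | E.1 x = 1} Complex.I = 0 := by
    simpa using supportFun_I_mul_eq_zero hne hF 1
  have hI' : supportFun F.1 {x | E.1 x = 1} (-Complex.I) = 0 := by
    simpa using supportFun_I_mul_eq_zero hne hF (-1)
  have h₀ := hturn 1
  have h₁ := hturn Complex.I
  have h₂ := hturn (-1)
  have h₃ := hturn (-Complex.I)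
  simp only [mul_one, mul_neg, Complex.I_mul_I, neg_neg, hI, hI'] at h₀ h₁ h₂ h₃
  exact ⟨by linarith, by linarith, by linarith⟩

variable [T2Space K₂]

theorem im_map_eq_zero (hU : IsAugmentedIsometry d₁ d₂ U) (hd₁ : d₁ 1 = 0) (hd₂ : d₂ 1 = 0)
    (hU1 : U 1 = 1) (hstar₁ : ∀ f ∈ A₁, star f ∈ A₁) (hsep₂ : A₂.SeparatesPoints)
    (hstar₂ : ∀ f ∈ A₂, star f ∈ A₂) (hF : ∀ x, (F.1 x).im = 0) (p : K₂) :
    ((U F).1 p).im = 0 := by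
  suffices hpos : ∀ {H : A₁}, (∀ x, (H.1 x).im = 0) → ¬ 0 < ((U H).1 p).im by
    refine le_antisymm (not_lt.1 (hpos hF)) (not_lt.1 fun hneg => hpos (H := -F) ?_ ?_)
    · exact fun x => by simp [hF]
    · simpa [map_neg] using hneg
  intro H hH hp
  obtain ⟨G, hGA, hG, hGW⟩ := exists_isPeakFunction hsep₂ hstar₂
    (isOpen_lt continuous_const (by fun_prop) : IsOpen {x | 0 < ((U H).1 x).im}) ⟨p, hp⟩
  obtain ⟨E, hE⟩ := U.surjective ⟨G, hGA⟩
  obtain rfl : (U E).1 = G := congrArg Subtype.val hE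
  have hsymm := (hU.supportFun_eq_of_real hd₁ hd₂ hU1 hG hstar₁ hH).1
  obtain ⟨x, hx, hxI⟩ := exists_re_eq_supportFun (isClosed_peakSet _) hG.exists_eq_one (U H).1
    Complex.I
  have hle := re_le_supportFun (f := (U H).1) hx (-Complex.I)
  have hxW : 0 < ((U H).1 x).im := hGW hx
  rw [← hsymm, ← hxI] at hle
  simp only [neg_mul, Complex.neg_re, Complex.I_mul_re] at hle
  linarith

theorem supportFun_preimage_peakSet (hU : IsAugmentedIsometry d₁ d₂ U) (hd₁ : d₁ 1 = 0)
    (hd₂ : d₂ 1 = 0) (hU1 : U 1 = 1) (hE : IsPeakFunction (U E).1)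
    (hstar₁ : ∀ f ∈ A₁, star f ∈ A₁) (hsep₂ : A₂.SeparatesPoints)
    (hstar₂ : ∀ f ∈ A₂, star f ∈ A₂) (hF : ∀ x, (F.1 x).im = 0) :
    supportFun F.1 {x | E.1 x = 1} 1 = supportFun (U F).1 {x | (U E).1 x = 1} 1 ∧
      supportFun F.1 {x | E.1 x = 1} (-1) = supportFun (U F).1 {x | (U E).1 x = 1} (-1) := by
  have hreal := hU.im_map_eq_zero hd₁ hd₂ hU1 hstar₁ hsep₂ hstar₂ hF
  have hne : {x | (U E).1 x = 1}.Nonempty := hE.exists_eq_one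
  have hI : supportFun (U F).1 {x | (U E).1 x = 1} Complex.I = 0 := by
    simpa using supportFun_I_mul_eq_zero hne hreal 1
  obtain ⟨hsymm, h₁, h₂⟩ := hU.supportFun_eq_of_real hd₁ hd₂ hU1 hE hstar₁ hF
  exact ⟨by linarith, by linarith⟩

theorem exists_mem_Icc_of_mem_nhds (hU : IsAugmentedIsometry d₁ d₂ U) (hd₁ : d₁ 1 = 0)
    (hd₂ : d₂ 1 = 0) (hU1 : U 1 = 1) (hstar₁ : ∀ f ∈ A₁, star f ∈ A₁)
    (hsep₂ : A₂.SeparatesPoints) (hstar₂ : ∀ f ∈ A₂, star f ∈ A₂) {p : K₂} {W : Set K₂}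
    (hW : W ∈ 𝓝 p) :
    ∃ q : K₁, ∀ F : A₁, (∀ x, (F.1 x).im = 0) →
      ∃ y ∈ W, ∃ z ∈ W, (F.1 q).re ∈ Set.Icc ((U F).1 y).re ((U F).1 z).re := by
  obtain ⟨G, hGA, hG, hGW⟩ := exists_isPeakFunction hsep₂ hstar₂ isOpen_interior
    ⟨p, mem_interior_iff_mem_nhds.2 hW⟩
  obtain ⟨E, hE⟩ := U.surjective ⟨G, hGA⟩
  obtain rfl : (U E).1 = G := congrArg Subtype.val hE
  obtain ⟨q, hq⟩ := hU.nonempty_preimage_peakSet hd₁ hd₂ hU1 hG hstar₁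
  refine ⟨q, fun F hF => ?_⟩
  obtain ⟨hsup, hinf⟩ := hU.supportFun_preimage_peakSet hd₁ hd₂ hU1 hG hstar₁ hsep₂ hstar₂ hF
  obtain ⟨z, hz, hmax⟩ := exists_re_eq_supportFun (isClosed_peakSet _) hG.exists_eq_one (U F).1 1
  obtain ⟨y, hy, hmin⟩ := exists_re_eq_supportFun (isClosed_peakSet _) hG.exists_eq_one (U F).1
    (-1)
  refine ⟨y, interior_subset (hGW hy), z, interior_subset (hGW hz), ?_, ?_⟩
  · have hle := re_le_supportFun (f := F.1) hq (-1)
    rw [hinf, ← hmin] at hle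
    simpa using hle
  · have hle := re_le_supportFun (f := F.1) hq 1
    rw [hsup, ← hmax] at hle
    simpa using hle

theorem exists_forall_apply_eq_of_real (hU : IsAugmentedIsometry d₁ d₂ U) (hd₁ : d₁ 1 = 0)
    (hd₂ : d₂ 1 = 0) (hU1 : U 1 = 1) (hstar₁ : ∀ f ∈ A₁, star f ∈ A₁)
    (hsep₂ : A₂.SeparatesPoints) (hstar₂ : ∀ f ∈ A₂, star f ∈ A₂) (p : K₂) :
    ∃ x : K₁, ∀ F : A₁, (∀ y, (F.1 y).im = 0) → (U F).1 p = F.1 x := by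
  let Z : Set K₂ → Set K₁ := fun W => {q | ∀ F : A₁, (∀ x, (F.1 x).im = 0) →
    ∃ y ∈ W, ∃ z ∈ W, (F.1 q).re ∈ Set.Icc ((U F).1 y).re ((U F).1 z).re}
  have hmono : Monotone Z := fun W W' hWW' q hq F hF => by
    obtain ⟨y, hy, z, hz, hmem⟩ := hq F hF
    exact ⟨y, hWW' hy, z, hWW' hz, hmem⟩
  have : ((𝓝 p).lift' Z).NeBot := (lift'_neBot_iff hmono).2 fun W hW =>
    hU.exists_mem_Icc_of_mem_nhds hd₁ hd₂ hU1 hstar₁ hsep₂ hstar₂ hW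
  obtain ⟨x, hx⟩ := exists_clusterPt_of_compactSpace ((𝓝 p).lift' Z)
  refine ⟨x, fun F hF => Complex.ext ?_ ?_⟩
  · have hcont : Continuous fun y => ((U F).1 y).re := by fun_prop
    have hlim : Tendsto (fun q => (F.1 q).re) ((𝓝 p).lift' Z) (𝓝 ((U F).1 p).re) := by
      refine tendsto_order.2 ⟨fun a ha => ?_, fun b hb => ?_⟩
      · refine mem_of_superset (mem_lift' (hcont.continuousAt.eventually_const_lt ha))
          fun q hq => ?_
        obtain ⟨y, hy, -, -, hle, -⟩ := hq F hF
        exact hy.trans_le hle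
      · refine mem_of_superset (mem_lift' (hcont.continuousAt.eventually_lt_const hb))
          fun q hq => ?_
        obtain ⟨-, -, z, hz, -, hle⟩ := hq F hF
        exact hle.trans_lt hz
    have hFx : Tendsto (fun q => (F.1 q).re) (𝓝 x) (𝓝 (F.1 x).re) :=
      Continuous.tendsto (by fun_prop) x
    have := hx.neBot
    exact tendsto_nhds_unique (hlim.mono_left inf_le_right) (hFx.mono_left inf_le_left)
  · rw [hU.im_map_eq_zero hd₁ hd₂ hU1 hstar₁ hsep₂ hstar₂ hF, hF]

theorem exists_forall_apply_eq (hU : IsAugmentedIsometry d₁ d₂ U) (hd₁ : d₁ 1 = 0)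
    (hd₂ : d₂ 1 = 0) (hU1 : U 1 = 1) (hstar₁ : ∀ f ∈ A₁, star f ∈ A₁)
    (hsep₂ : A₂.SeparatesPoints) (hstar₂ : ∀ f ∈ A₂, star f ∈ A₂) (p : K₂) :
    ∃ x : K₁, ∀ F : A₁, (U F).1 p = F.1 x := by
  obtain ⟨x, hx⟩ := hU.exists_forall_apply_eq_of_real hd₁ hd₂ hU1 hstar₁ hsep₂ hstar₂ p
  refine ⟨x, fun F => ?_⟩
  obtain ⟨P, Q, hP, hQ, rfl⟩ := exists_real_add_I_smul_real hstar₁ F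
  rw [map_add U, map_smul U]
  change (U P).1 p + Complex.I * (U Q).1 p = P.1 x + Complex.I * Q.1 x
  rw [hx P hP, hx Q hQ]

theorem exists_homeomorph_of_map_one [T2Space K₁] [Nonempty K₂]
    (hU : IsAugmentedIsometry d₁ d₂ U) (hd₁ : d₁ 1 = 0) (hd₂ : d₂ 1 = 0) (hU1 : U 1 = 1)
    (hsep₁ : A₁.SeparatesPoints) (hstar₁ : ∀ f ∈ A₁, star f ∈ A₁)
    (hsep₂ : A₂.SeparatesPoints) (hstar₂ : ∀ f ∈ A₂, star f ∈ A₂) :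
    ∃ σ : K₂ ≃ₜ K₁, ∀ (F : A₁) (p : K₂), (U F).1 p = F.1 (σ p) := by
  choose σ hσ using hU.exists_forall_apply_eq hd₁ hd₂ hU1 hstar₁ hsep₂ hstar₂
  choose σ' hσ' using hU.symm.exists_forall_apply_eq hd₂ hd₁
    (by rw [← hU1, U.symm_apply_apply]) hstar₂ hsep₁ hstar₁
  have hσ_cont : Continuous σ := continuous_of_forall_comp hsep₁ fun F => by
    simpa only [← hσ] using (U F).1.continuous
  have hσ'_cont : Continuous σ' := continuous_of_forall_comp hsep₂ fun F => by
    simpa only [← hσ'] using (U.symm F).1.continuous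
  refine ⟨⟨⟨σ, σ', fun p => ?_, fun x => ?_⟩, hσ_cont, hσ'_cont⟩, fun F p => hσ p F⟩
  · refine eq_of_forall_apply_eq hsep₂ fun F => ?_
    rw [← hσ', ← hσ, U.apply_symm_apply]
  · refine eq_of_forall_apply_eq hsep₁ fun F => ?_
    rw [← hσ, ← hσ', U.symm_apply_apply]

theorem exists_homeomorph [T2Space K₁] [Nonempty K₂]
    (hU : IsAugmentedIsometry d₁ d₂ U) (hd₁ : d₁ 1 = 0) (hd₂ : d₂ 1 = 0)
    (hsep₁ : A₁.SeparatesPoints) (hstar₁ : ∀ f ∈ A₁, star f ∈ A₁)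
    (hsep₂ : A₂.SeparatesPoints) (hstar₂ : ∀ f ∈ A₂, star f ∈ A₂) :
    (∀ p, ‖(U 1).1 p‖ = 1) ∧ d₂ (U 1) = 0 ∧
      ∃ σ : K₂ ≃ₜ K₁, ∀ (F : A₁) (p : K₂), (U F).1 p = (U 1).1 p * F.1 (σ p) := by
  have hone := hU.norm_map_one hd₁ hd₂ hsep₂ hstar₂
  have hunit (p : K₂) : ‖(U 1).1 p‖ = 1 :=
    (hU.norm_map_one_apply hd₁ hd₂ hsep₂ hstar₂ p).trans hone
  have hd₂U : d₂ (U 1) = 0 := by linarith [hU.norm_map_one_add hd₁]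
  let m' : A₂ := ⟨star (U 1).1, hstar₂ _ (U 1).2⟩
  have hmm' : U 1 * m' = 1 := Subtype.ext <| ContinuousMap.ext fun p => by
    simp [m', Complex.mul_conj', hunit]
  have hm'm : m' * U 1 = 1 := by rw [mul_comm, hmm']
  let L : A₂ →ₗ[ℂ] A₂ := LinearMap.mulLeft ℂ (U 1)
  let E : A₂ ≃ₗ[ℂ] A₂ := LinearEquiv.ofLinearMap (LinearMap.mulLeft ℂ m') L
    (LinearMap.ext fun F => by simp [L, ← mul_assoc, hm'm])
    (LinearMap.ext fun F => by simp [L, ← mul_assoc, hmm'])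
  let V : A₁ ≃ₗ[ℂ] A₂ := U.trans E
  have hUV (F : A₁) : U F = U 1 * V F := by
    change U F = U 1 * (m' * U F)
    rw [← mul_assoc, hmm', one_mul]
  let d : Seminorm ℂ A₂ := d₂.comp L
  have hV : IsAugmentedIsometry d₁ d V := fun F => by
    have hnorm : ‖(U F).1‖ = ‖(V F).1‖ := by
      rw [hUV]
      exact norm_mul_of_forall_norm_eq_one hunit _
    rw [← hU, hnorm, hUV]
    rfl
  have hV1 : V 1 = 1 := hm'm
  have hd : d 1 = 0 := by
    change d₂ (U 1 * 1) = 0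
    rw [mul_one, hd₂U]
  obtain ⟨σ, hσ⟩ := hV.exists_homeomorph_of_map_one hd₁ hd hV1 hsep₁ hstar₁ hsep₂ hstar₂
  refine ⟨hunit, hd₂U, σ, fun F p => ?_⟩
  rw [← hσ, hUV]
  rfl

end IsAugmentedIsometry

end UnitalComposition

section Product

theorem exists_complex_apply_ne {Y : Type*} [TopologicalSpace Y] [CompactSpace Y] [T2Space Y]
    {y y' : Y} (h : y ≠ y') : ∃ g : C(Y, ℂ), g y ≠ g y' := by
  obtain ⟨e, he⟩ := exists_continuous_zero_one_of_isClosed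
    (isClosed_singleton (x := y)) (isClosed_singleton (x := y')) (by simpa using h)
  have he0 : e y = 0 := he.1 rfl
  have he1 : e y' = 1 := he.2.1 rfl
  refine ⟨⟨fun x => (e x : ℂ), by fun_prop⟩, ?_⟩
  simp [he0, he1]

theorem exists_fiberwise_homeomorph {X₁ X₂ Y₁ Y₂ : Type*}
    [TopologicalSpace X₁] [T2Space X₁] [Nonempty X₁]
    [TopologicalSpace X₂] [CompactSpace X₂] [Nonempty X₂]
    [TopologicalSpace Y₁] [TopologicalSpace Y₂]
    (σ : X₂ × Y₂ ≃ₜ X₁ × Y₁) (h : ∀ x x' y, (σ (x, y)).2 = (σ (x', y)).2)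
    (h' : ∀ x x' y, (σ.symm (x, y)).2 = (σ.symm (x', y)).2) :
    ∃ (φ : C(X₂ × Y₂, X₁)) (τ : Y₂ ≃ₜ Y₁), (∀ y, IsHomeomorph fun x => φ (x, y)) ∧
      ∀ x y, σ (x, y) = (φ (x, y), τ y) := by
  obtain ⟨a₁⟩ := ‹Nonempty X₁›
  obtain ⟨a₂⟩ := ‹Nonempty X₂›
  have hleft : ∀ x y, (σ.symm (x, (σ (a₂, y)).2)).2 = y := fun x y => by
    rw [h' x (σ (a₂, y)).1, Prod.mk.eta, σ.symm_apply_apply]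
  have hright : ∀ x y, (σ (x, (σ.symm (a₁, y)).2)).2 = y := fun x y => by
    rw [h x (σ.symm (a₁, y)).1, Prod.mk.eta, σ.apply_symm_apply]
  let φ : C(X₂ × Y₂, X₁) := ⟨fun p => (σ p).1, by fun_prop⟩
  let τ : Y₂ ≃ₜ Y₁ := ⟨⟨fun y => (σ (a₂, y)).2, fun y => (σ.symm (a₁, y)).2, hleft a₁, hright a₂⟩,
    by fun_prop, by fun_prop⟩
  have hσ : ∀ x y, σ (x, y) = (φ (x, y), τ y) := fun x y => Prod.ext rfl (h x a₂ y)
  refine ⟨φ, τ, fun y => ?_, hσ⟩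
  rw [isHomeomorph_iff_continuous_bijective]
  refine ⟨by fun_prop, fun x x' hxx' => ?_, fun x => ⟨(σ.symm (x, τ y)).1, ?_⟩⟩
  · have hxx' : φ (x, y) = φ (x', y) := hxx'
    have hσxx' : σ (x, y) = σ (x', y) := by rw [hσ, hσ, hxx']
    exact congrArg Prod.fst (σ.injective hσxx')
  · have hmk : ((σ.symm (x, τ y)).1, y) = σ.symm (x, τ y) := Prod.ext rfl (hleft x y).symm
    change (σ ((σ.symm (x, τ y)).1, y)).1 = x
    rw [hmk, σ.apply_symm_apply]

variable {X₁ X₂ Y₁ Y₂ : Type*}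
  [TopologicalSpace X₁] [CompactSpace X₁] [TopologicalSpace Y₁] [CompactSpace Y₁] [T2Space Y₁]
  [TopologicalSpace X₂] [CompactSpace X₂] [TopologicalSpace Y₂] [CompactSpace Y₂]
  {A₁ : Subalgebra ℂ C(X₁ × Y₁, ℂ)} {A₂ : Subalgebra ℂ C(X₂ × Y₂, ℂ)}
  {d₁ : Seminorm ℂ A₁} {d₂ : Seminorm ℂ A₂} {U : A₁ ≃ₗ[ℂ] A₂}

/-- The part of the notion of a natural `C(Y)`-valuezation, with norm `‖F‖ + d F`, that determines
the isometries: in place of `‖D F‖` there is any seminorm with kernel `1 ⊗ C(Y)`, and neither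
completeness nor naturality is required. -/
structure IsSeminormValuezation {X Y : Type*} [TopologicalSpace X] [TopologicalSpace Y]
    (A : Subalgebra ℂ C(X × Y, ℂ)) (d : Seminorm ℂ A) : Prop where
  separatesPoints : A.SeparatesPoints
  star_mem : ∀ f ∈ A, star f ∈ A
  tensorFun_one_mem : ∀ g : C(Y, ℂ), tensorFun 1 g ∈ A
  eq_zero_iff : ∀ F : A, d F = 0 ↔ ∃ g : C(Y, ℂ), (F : C(X × Y, ℂ)) = tensorFun 1 g

namespace IsSeminormValuezation

theorem map_one {X Y : Type*} [TopologicalSpace X] [TopologicalSpace Y]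
    {A : Subalgebra ℂ C(X × Y, ℂ)} {d : Seminorm ℂ A} (hA : IsSeminormValuezation A d) :
    d 1 = 0 :=
  (hA.eq_zero_iff 1).2 ⟨1, by ext p; simp [tensorFun]⟩

theorem snd_apply_eq_of_map_eq_mul_comp (hA₁ : IsSeminormValuezation A₁ d₁)
    (hA₂ : IsSeminormValuezation A₂ d₂) (hU : IsAugmentedIsometry d₁ d₂ U)
    {m : X₂ × Y₂ → ℂ} {σ : X₂ × Y₂ ≃ₜ X₁ × Y₁} (hm : ∀ p, ‖m p‖ = 1)
    (hσ : ∀ (F : A₁) (p : X₂ × Y₂), (U F).1 p = m p * F.1 (σ p)) (x x' : X₂) (y : Y₂) :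
    (σ (x, y)).2 = (σ (x', y)).2 := by
  have hd (F : A₁) : d₂ (U F) = d₁ F := by
    have hnorm : ‖(U F).1‖ = ‖F.1‖ := by
      rw [ContinuousMap.norm_eq_iSup_norm, ContinuousMap.norm_eq_iSup_norm,
        ← σ.surjective.iSup_comp (g := fun q => ‖F.1 q‖)]
      simp only [hσ, norm_mul, hm, one_mul]
    have := hU F
    rwa [hnorm, add_right_inj] at this
  have hmap (g : C(Y₁, ℂ)) : ∃ g' : C(Y₂, ℂ), ∀ x y, m (x, y) * g (σ (x, y)).2 = g' y := by
    let F : A₁ := ⟨tensorFun 1 g, hA₁.tensorFun_one_mem g⟩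
    obtain ⟨g', hg'⟩ := (hA₂.eq_zero_iff (U F)).1 <| (hd F).trans <|
      (hA₁.eq_zero_iff F).2 ⟨g, rfl⟩
    refine ⟨g', fun x y => ?_⟩
    have := hσ F (x, y)
    rw [hg'] at this
    simpa [F, tensorFun] using this.symm
  obtain ⟨h, hh⟩ := hmap 1
  have hmh (x : X₂) (y : Y₂) : m (x, y) = h y := by simpa using hh x y
  by_contra hne
  obtain ⟨g, hg⟩ := exists_complex_apply_ne hne
  obtain ⟨g', hg'⟩ := hmap g
  have hy : h y ≠ 0 := norm_ne_zero_iff.1 (by simp [← hmh x, hm])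
  refine hg (mul_left_cancel₀ hy ?_)
  rw [← hmh x, hg', hmh x, ← hmh x', hg']

end IsSeminormValuezation

end Product

theorem IsNaturalValuezation.exists_isSeminormValuezation {X : Type u} {Y : Type v}
    [TopologicalSpace X] [CompactSpace X] [T2Space X]
    [TopologicalSpace Y] [CompactSpace Y] [T2Space Y]
    {B : Subalgebra ℂ C(X, ℂ)} {nB : AlgebraNorm ℂ B}
    {Bt : Subalgebra ℂ C(X × Y, ℂ)} {nBt : AlgebraNorm ℂ Bt}
    (hv : IsNaturalValuezation.{u, v, w} B nB Bt nBt) :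
    ∃ d : Seminorm ℂ Bt, IsSeminormValuezation Bt d ∧
      ∀ F : Bt, nBt F = ‖(F : C(X × Y, ℂ))‖ + d F := by
  obtain ⟨M, _, _, _, D, hker, -, hnorm⟩ := hv.exists_map
  refine ⟨(normSeminorm ℂ C(M, ℂ)).comp D, ⟨hv.separates, hv.selfAdjoint.2, fun g => ?_,
    fun F => ?_⟩, fun F => ?_⟩
  · exact hv.tensor_le (Submodule.subset_span ⟨1, B.one_mem, g, trivial, rfl⟩)
  · rw [← hker, Seminorm.comp_apply, coe_normSeminorm, norm_eq_zero]
  · rw [hnorm, Seminorm.comp_apply, coe_normSeminorm]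

theorem theorem5p1_general {X₁ X₂ Y₁ Y₂ : Type*}
    [TopologicalSpace X₁] [CompactSpace X₁] [T2Space X₁] [Nonempty X₁]
    [TopologicalSpace X₂] [CompactSpace X₂] [T2Space X₂] [Nonempty X₂]
    [TopologicalSpace Y₁] [CompactSpace Y₁] [T2Space Y₁] [Nonempty Y₁]
    [TopologicalSpace Y₂] [CompactSpace Y₂] [T2Space Y₂] [Nonempty Y₂]
    {A₁ : Subalgebra ℂ C(X₁ × Y₁, ℂ)} {A₂ : Subalgebra ℂ C(X₂ × Y₂, ℂ)}
    {d₁ : Seminorm ℂ A₁} {d₂ : Seminorm ℂ A₂}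
    (hA₁ : IsSeminormValuezation A₁ d₁) (hA₂ : IsSeminormValuezation A₂ d₂)
    (U : A₁ →ₗ[ℂ] A₂) (hU : Function.Surjective U)
    (hiso : ∀ F, ‖(U F).1‖ + d₂ (U F) = ‖F.1‖ + d₁ F) :
    ∃ (h : C(Y₂, ℂ)) (φ : C(X₂ × Y₂, X₁)) (τ : Y₂ ≃ₜ Y₁),
      (∀ y, ‖h y‖ = 1) ∧ (∀ y, IsHomeomorph fun x => φ (x, y)) ∧
      ∀ (F : A₁) (x : X₂) (y : Y₂), (U F).1 (x, y) = h y * F.1 (φ (x, y), τ y) := by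
  let V : A₁ ≃ₗ[ℂ] A₂ := LinearEquiv.ofBijective U ⟨injective_of_norm_add_seminorm_eq hiso, hU⟩
  have hV : IsAugmentedIsometry d₁ d₂ V := hiso
  obtain ⟨hunit, hd₂V, σ, hσ⟩ := hV.exists_homeomorph hA₁.map_one hA₂.map_one
    hA₁.separatesPoints hA₁.star_mem hA₂.separatesPoints hA₂.star_mem
  have hσsymm (F : A₂) (p : X₁ × Y₁) :
      (V.symm F).1 p = ((V 1).1 (σ.symm p))⁻¹ * F.1 (σ.symm p) := by
    have hne : (V 1).1 (σ.symm p) ≠ 0 := norm_ne_zero_iff.1 (by simp [hunit])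
    have := hσ (V.symm F) (σ.symm p)
    rw [V.apply_symm_apply, σ.apply_symm_apply] at this
    rw [this, inv_mul_cancel_left₀ hne]
  obtain ⟨φ, τ, hφ, hφτ⟩ := exists_fiberwise_homeomorph σ
    (hA₁.snd_apply_eq_of_map_eq_mul_comp hA₂ hV hunit hσ)
    (hA₂.snd_apply_eq_of_map_eq_mul_comp hA₁ hV.symm (by simp [hunit]) hσsymm)
  obtain ⟨h, hh⟩ := (hA₂.eq_zero_iff (V 1)).1 hd₂V
  have hVh (x : X₂) (y : Y₂) : (V 1).1 (x, y) = h y := by simp [hh, tensorFun]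
  refine ⟨h, φ, τ, fun y => ?_, hφ, fun F x y => ?_⟩
  · rw [← hVh (Classical.arbitrary X₂), hunit]
  · rw [← hφτ, ← hVh x]
    exact hσ F (x, y)

theorem theorem5p1
    {X₁ X₂ Y₁ Y₂ : Type*}
    [TopologicalSpace X₁] [CompactSpace X₁] [T2Space X₁] [Nonempty X₁]
    [TopologicalSpace X₂] [CompactSpace X₂] [T2Space X₂] [Nonempty X₂]
    [TopologicalSpace Y₁] [CompactSpace Y₁] [T2Space Y₁] [Nonempty Y₁]
    [TopologicalSpace Y₂] [CompactSpace Y₂] [T2Space Y₂] [Nonempty Y₂]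
    (B₁ : Subalgebra ℂ C(X₁, ℂ)) (nB₁ : AlgebraNorm ℂ B₁)
    (Bt₁ : Subalgebra ℂ C(X₁ × Y₁, ℂ)) (nBt₁ : AlgebraNorm ℂ Bt₁)
    (B₂ : Subalgebra ℂ C(X₂, ℂ)) (nB₂ : AlgebraNorm ℂ B₂)
    (Bt₂ : Subalgebra ℂ C(X₂ × Y₂, ℂ)) (nBt₂ : AlgebraNorm ℂ Bt₂)
    (hv₁ : IsNaturalValuezation.{_, _, w₁} B₁ nB₁ Bt₁ nBt₁)
    (hv₂ : IsNaturalValuezation.{_, _, w₂} B₂ nB₂ Bt₂ nBt₂)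
    (hinv₁ : ∀ (h : C(Y₁, ℂ)), (∀ y, ‖h y‖ = 1) → ∀ F G : Bt₁,
      (G : C(X₁ × Y₁, ℂ)) = tensorFun 1 h * (F : C(X₁ × Y₁, ℂ)) → nBt₁ G = nBt₁ F)
    (hinv₂ : ∀ (h : C(Y₂, ℂ)), (∀ y, ‖h y‖ = 1) → ∀ F G : Bt₂,
      (G : C(X₂ × Y₂, ℂ)) = tensorFun 1 h * (F : C(X₂ × Y₂, ℂ)) → nBt₂ G = nBt₂ F)
    (U : Bt₁ →ₗ[ℂ] Bt₂) (hU : Function.Surjective U) (hiso : ∀ F : Bt₁, nBt₂ (U F) = nBt₁ F) :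
    ∃ (h : C(Y₂, ℂ)) (φ : C(X₂ × Y₂, X₁)) (τ : Y₂ ≃ₜ Y₁),
      (∀ y, ‖h y‖ = 1) ∧
      (∀ y, IsHomeomorph (fun x => φ (x, y))) ∧
      ∀ (F : Bt₁) (x : X₂) (y : Y₂),
        (U F : C(X₂ × Y₂, ℂ)) (x, y) = h y * (F : C(X₁ × Y₁, ℂ)) (φ (x, y), τ y) := by
  obtain ⟨d₁, hd₁, hn₁⟩ := hv₁.exists_isSeminormValuezation
  obtain ⟨d₂, hd₂, hn₂⟩ := hv₂.exists_isSeminormValuezation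
  exact theorem5p1_general hd₁ hd₂ U hU fun F => by rw [← hn₁, ← hn₂, hiso]
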